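/- **Lemma 2.3.** Let $n\in\{2,3\}$ and let $\Omega\subset\mathbb R^n$ be a bounded, convex, open set. Let $a_{ij},c_0\in L^\infty(\Omega)$ ($1\le i,j\le n$) with $a_{ij}=a_{ji}$ and $c_0\ge 0$ a.e. in $\Omega$, and suppose there is $\theta>0$ with $\sum_{i,j}a_{ij}(x)\xi_i\xi_j\ge\theta\|\xi\|^2$ for a.a. $x\in\Omega$ and all $\xi\in\mathbb R^n$. Let $Y=H^1_0(\Omega)$ and $U=L^2(\Omega)$, define $A\in\mathcal L(Y,Y^*)$ by $$(Ay)(v)=\int_\Omega\Big(\sum_{i,j=1}^n a_{ij}\,y_{x_i}v_{x_j}+c_0\,y\,v\Big)\,dx ,$$ and define $B\in\mathcal L(U,Y^*)$ by $(Bu)(v)=(u,v)_{L^2(\Omega)}$. Let $y_d,y_r\in L^2(\Omega)$, let $a\le 0\le b$ be real numbers, let $\alpha,\beta>0$, and consider the problem $$(\mathrm P)\qquad \min_{(y,u)\in Y\times U}\ \tfrac12\|y-y_d\|_{L^2(\Omega)}^2+\tfrac{\alpha}{2}\|u\|_{L^2(\Omega)}^2+\beta\|u\|_{L^1(\Omega)}\quad\text{s.t.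 } Ay=B(u+y_r),\ \ a\le u\le b\ \text{ a.e. on }\Omega .$$ Then $A$ has a bounded inverse. Put $$\beta_0:=\big\|(A^{-1})^*(y_d-A^{-1}By_r)\big\|_{L^\infty(\Omega)}\in[0,\infty],$$ where $(A^{-1})^*:Y^*\to Y^{**}=Y$ is the adjoint of $A^{-1}:Y^*\to Y$ and $f\in L^2(\Omega)$ is identified with $Bf\in Y^*$. If $\beta\ge\beta_0$, then the unique solution of $(\mathrm P)$ is $(y^*_\beta,u^*_\beta)=(A^{-1}By_r,\,0)$. -/

import Mathlib

open MeasureTheory TopologicalSpace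
open scoped ENNReal ContDiff Distributions

noncomputable section

namespace SparseControl

/-- The space `ℝⁿ` with its Euclidean norm. -/
abbrev Sp (n : ℕ) : Type := EuclideanSpace ℝ (Fin n)

variable {n : ℕ} (Ω : Opens (Sp n))

/-- Lebesgue measure on `Ω`. -/
abbrev vol : Measure (Sp n) := volume.restrict (Ω : Set (Sp n))

/-- `L²(Ω)`; this is also the control space `U`. -/
abbrev L2 : Type := Lp ℝ 2 (vol Ω)

/-- `L²(Ω; ℝⁿ)`. -/
abbrev L2Vec : Type := Lp (Sp n) 2 (vol Ω)

/-- `L^∞(Ω)`. -/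
abbrev Linf : Type := Lp ℝ ∞ (vol Ω)

/-- The Hilbert space of pairs `(y, g)` with `y ∈ L²(Ω)` and `g ∈ L²(Ω; ℝⁿ)`; its norm restricts to
the `H¹`-norm `(‖y‖² + ‖∇y‖²)^{1/2}` on the pairs `(y, ∇y)`. -/
abbrev Jet : Type := WithLp 2 (L2 Ω × L2Vec Ω)

/-- The pairs `(φ, ∇φ)` with `φ ∈ C_c^∞(Ω)`. -/
def testJets : Submodule ℝ (Jet Ω) where
  carrier := {w | ∃ φ : 𝓓(Ω, ℝ), w.fst =ᵐ[vol Ω] φ ∧ w.snd =ᵐ[vol Ω] gradient φ}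
  zero_mem' := by
    refine ⟨0, ?_, ?_⟩
    · exact Lp.coeFn_zero ℝ 2 (vol Ω)
    · have h : gradient (0 : 𝓓(Ω, ℝ)) = fun _ => (0 : Sp n) := by
        funext x
        simp [gradient, FunLike.coe_zero]
      rw [h]
      exact Lp.coeFn_zero (Sp n) 2 (vol Ω)
  add_mem' := by
    rintro v w ⟨φ, h1, h2⟩ ⟨ψ, h3, h4⟩
    refine ⟨φ + ψ, ?_, ?_⟩
    · filter_upwards [Lp.coeFn_add v.fst w.fst, h1, h3] with x hx h1 h3
      have : (v + w).fst x = (v.fst + w.fst) x := rfl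
      rw [this, hx, FunLike.coe_add, Pi.add_apply, Pi.add_apply, h1, h3]
    · filter_upwards [Lp.coeFn_add v.snd w.snd, h2, h4] with x hx h2 h4
      have : (v + w).snd x = (v.snd + w.snd) x := rfl
      rw [this, hx, Pi.add_apply, h2, h4, FunLike.coe_add]
      unfold gradient
      rw [fderiv_add (φ.contDiff.differentiable (by simp) x)
        (ψ.contDiff.differentiable (by simp) x), map_add]
  smul_mem' := by
    rintro c v ⟨φ, h1, h2⟩
    refine ⟨c • φ, ?_, ?_⟩
    · filter_upwards [Lp.coeFn_smul c v.fst, h1] with x hx h1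
      have : (c • v).fst x = (c • v.fst) x := rfl
      rw [this, hx, FunLike.coe_smul, Pi.smul_apply, Pi.smul_apply, h1]
    · filter_upwards [Lp.coeFn_smul c v.snd, h2] with x hx h2
      have : (c • v).snd x = (c • v.snd) x := rfl
      rw [this, hx, Pi.smul_apply, h2, FunLike.coe_smul]
      unfold gradient
      rw [fderiv_const_smul (φ.contDiff.differentiable (by simp) x)]
      simp

/-- The state space `Y = H₀¹(Ω)`: the closure of `C_c^∞(Ω)` with respect to the `H¹`-norm, a
function `y` being stored together with its weak gradient as the pair `(y, ∇y)`. That the second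
component is the weak gradient of the first, and is determined by it, is proved below. -/
def H10 : Submodule ℝ (Jet Ω) := (testJets Ω).topologicalClosure

instance : CompleteSpace (H10 Ω) :=
  (Submodule.isClosed_topologicalClosure (testJets Ω)).completeSpace_coe

/-- `g` is the weak gradient of `y` on `Ω`. -/
def HasWeakGradient (y : L2 Ω) (g : L2Vec Ω) : Prop :=
  ∀ φ : 𝓓(Ω, ℝ), ∀ i : Fin n,
    ∫ x in Ω, y x * gradient φ x i = -∫ x in Ω, g x i * φ x

variable {Ω}

/-- The embedding `H₀¹(Ω) → L²(Ω)`, `y ↦ y`. -/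
def val : H10 Ω →L[ℝ] L2 Ω :=
  (WithLp.fstL 2 ℝ (L2 Ω) (L2Vec Ω)).comp (H10 Ω).subtypeL

/-- The weak gradient `H₀¹(Ω) → L²(Ω; ℝⁿ)`, `y ↦ ∇y`. -/
def grad : H10 Ω →L[ℝ] L2Vec Ω :=
  (WithLp.sndL 2 ℝ (L2 Ω) (L2Vec Ω)).comp (H10 Ω).subtypeL

/-- The weak partial derivative `y ↦ y_{x_i}`. -/
def pderiv (i : Fin n) : H10 Ω →L[ℝ] L2 Ω :=
  ((EuclideanSpace.proj i : Sp n →L[ℝ] ℝ).compLpL 2 (vol Ω)).comp grad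

/-- The bilinear form `a(y, v) = ∫_Ω (∑_{i,j} a_{ij} y_{x_i} v_{x_j} + c₀ y v) dx`. -/
def form (a : Fin n → Fin n → Linf Ω) (c₀ : Linf Ω) (y v : H10 Ω) : ℝ :=
  ∫ x in Ω, ((∑ i, ∑ j, a i j x * pderiv i y x * pderiv j v x) + c₀ x * val y x * val v x)

/-- The classical gradient of a test function is its weak gradient. -/
theorem hasWeakGradient_of_test {w : Jet Ω} (hw : w ∈ testJets Ω) :
    HasWeakGradient Ω w.fst w.snd := by
  obtain ⟨ψ, h1, h2⟩ := hw
  intro φ i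
  have hg : ∀ (χ : 𝓓(Ω, ℝ)) (x : Sp n),
      gradient χ x i = fderiv ℝ χ x (EuclideanSpace.single i 1) := by
    intro χ x
    rw [← inner_gradient_left]
    simp [EuclideanSpace.inner_single_right, -inner_gradient_left]
  have dφ : Continuous fun x => fderiv ℝ φ x (EuclideanSpace.single i 1) :=
    (φ.contDiff.continuous_fderiv (by simp)).clm_apply continuous_const
  have dψ : Continuous fun x => fderiv ℝ ψ x (EuclideanSpace.single i 1) :=
    (ψ.contDiff.continuous_fderiv (by simp)).clm_apply continuous_const
  have e1 : ∫ x in Ω, w.fst x * gradient φ x i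
      = ∫ x, ψ x * fderiv ℝ φ x (EuclideanSpace.single i 1) := by
    rw [integral_congr_ae (g := fun x => ψ x * fderiv ℝ φ x (EuclideanSpace.single i 1))
      (by filter_upwards [h1] with x hx; rw [hx, hg])]
    refine setIntegral_eq_integral_of_forall_compl_eq_zero fun x hx => ?_
    rw [image_eq_zero_of_notMem_tsupport fun h => hx (ψ.tsupport_subset h), zero_mul]
  have e2 : ∫ x in Ω, w.snd x i * φ x
      = ∫ x, fderiv ℝ ψ x (EuclideanSpace.single i 1) * φ x := by
    rw [integral_congr_ae (g := fun x => fderiv ℝ ψ x (EuclideanSpace.single i 1) * φ x)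
      (by filter_upwards [h2] with x hx; rw [hx, hg])]
    refine setIntegral_eq_integral_of_forall_compl_eq_zero fun x hx => ?_
    rw [image_eq_zero_of_notMem_tsupport fun h => hx (φ.tsupport_subset h), mul_zero]
  rw [e1, e2]
  exact integral_mul_fderiv_eq_neg_fderiv_mul_of_integrable
    ((dψ.mul φ.continuous).integrable_of_hasCompactSupport φ.hasCompactSupport.mul_left)
    ((ψ.continuous.mul dφ).integrable_of_hasCompactSupport ψ.hasCompactSupport.mul_right)
    ((ψ.continuous.mul φ.continuous).integrable_of_hasCompactSupport
      ψ.hasCompactSupport.mul_right)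
    (fun x _ => ψ.contDiff.differentiable (by simp) x)
    (fun x _ => φ.contDiff.differentiable (by simp) x)

/-- The second component of an element of `H₀¹(Ω)` is the weak gradient of the first one. -/
theorem hasWeakGradient (y : H10 Ω) : HasWeakGradient Ω (val y) (grad y) := by
  have hint : ∀ (f : Sp n → ℝ), Continuous f → HasCompactSupport f → MemLp f 2 (vol Ω) :=
    fun f h1 h2 => (h1.memLp_of_hasCompactSupport h2).restrict _
  intro φ i
  have m1 : MemLp (fun x => gradient φ x i) 2 (vol Ω) := by
    have e : (fun x => gradient φ x i) = fun x => fderiv ℝ φ x (EuclideanSpace.single i 1) := by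
      funext x
      rw [← inner_gradient_left]
      simp [EuclideanSpace.inner_single_right, -inner_gradient_left]
    rw [e]
    exact hint _ ((φ.contDiff.continuous_fderiv (by simp)).clm_apply continuous_const)
      (φ.hasCompactSupport.fderiv_apply ℝ _)
  have m2 : MemLp φ 2 (vol Ω) := hint _ φ.continuous φ.hasCompactSupport
  let P : L2Vec Ω →L[ℝ] L2 Ω := (EuclideanSpace.proj i : Sp n →L[ℝ] ℝ).compLpL 2 (vol Ω)
  have k1 : ∀ g : L2 Ω, ∫ x in Ω, g x * gradient φ x i = inner ℝ g (m1.toLp _) := by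
    intro g
    rw [MeasureTheory.L2.inner_def]
    refine integral_congr_ae ?_
    filter_upwards [m1.coeFn_toLp] with x hx
    rw [hx]
    simp [mul_comm]
  have k2 : ∀ g : L2Vec Ω, ∫ x in Ω, g x i * φ x = inner ℝ (P g) (m2.toLp _) := by
    intro g
    rw [MeasureTheory.L2.inner_def]
    refine integral_congr_ae ?_
    filter_upwards [m2.coeFn_toLp,
      (EuclideanSpace.proj i : Sp n →L[ℝ] ℝ).coeFn_compLpL (p := 2) g] with x hx hx'
    rw [hx, hx']
    simp [mul_comm]
  have hcl : IsClosed {w : Jet Ω | (inner ℝ w.fst (m1.toLp _) : ℝ)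
      = -inner ℝ (P w.snd) (m2.toLp _)} := by
    have c1 : Continuous fun w : Jet Ω => w.fst := (WithLp.fstL 2 ℝ (L2 Ω) (L2Vec Ω)).continuous
    have c2 : Continuous fun w : Jet Ω => w.snd := (WithLp.sndL 2 ℝ (L2 Ω) (L2Vec Ω)).continuous
    exact isClosed_eq (c1.inner continuous_const)
      ((P.continuous.comp c2).inner continuous_const).neg
  have hsub : closure (testJets Ω : Set (Jet Ω)) ⊆ {w : Jet Ω | (inner ℝ w.fst (m1.toLp _) : ℝ)
      = -inner ℝ (P w.snd) (m2.toLp _)} := by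
    refine closure_minimal (fun w hw => ?_) hcl
    have := hasWeakGradient_of_test hw φ i
    rwa [k1, k2] at this
  rw [k1, k2]
  exact hsub y.2

/-- A function in `H₀¹(Ω)` determines its weak gradient, so `H₀¹(Ω)` is a space of functions. -/
theorem val_injective : Function.Injective (val (Ω := Ω)) := by
  refine (injective_iff_map_eq_zero _).2 fun y hy => ?_
  have hz : ∀ᵐ x ∂vol Ω, ∀ i, grad y x i = 0 := by
    refine ae_all_iff.2 fun i => ?_
    have hloc : LocallyIntegrableOn (fun x => grad y x i) (Ω : Set (Sp n)) volume := by
      have h2 : MemLp (fun x => grad y x i) 2 (vol Ω) :=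
        (EuclideanSpace.proj i : Sp n →L[ℝ] ℝ).comp_memLp (grad y)
      exact locallyIntegrableOn_of_locallyIntegrable_restrict
        (h2.locallyIntegrable (by norm_num))
    refine (ae_restrict_iff' Ω.isOpen.measurableSet).2 ?_
    refine Ω.isOpen.ae_eq_zero_of_integral_contDiff_smul_eq_zero hloc fun g hg hc hs => ?_
    have hw := hasWeakGradient y ⟨g, hg, hc, hs⟩ i
    have h0 : ∫ x in Ω, val y x * gradient g x i = 0 := by
      rw [hy]
      refine integral_eq_zero_of_ae ?_
      filter_upwards [Lp.coeFn_zero ℝ 2 (vol Ω)] with x hx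
      rw [hx]
      simp
    have h1 : ∫ x in Ω, grad y x i * g x = 0 := neg_eq_zero.1 (hw.symm.trans h0)
    rw [← h1, ← setIntegral_eq_integral_of_forall_compl_eq_zero (s := (Ω : Set (Sp n)))
      fun x hx => by
        rw [image_eq_zero_of_notMem_tsupport fun h => hx (hs h), zero_smul]]
    simp [mul_comm]
  have hg : grad y = 0 := by
    refine Lp.ext ?_
    filter_upwards [hz, Lp.coeFn_zero (Sp n) 2 (vol Ω)] with x hx h0
    rw [h0]
    ext i
    exact hx i
  refine Subtype.ext ((WithLp.ofLp_injective 2) (Prod.ext hy hg))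

theorem inner_smul_eq (f : Linf Ω) (g h : L2 Ω) :
    Integrable (fun x => f x * g x * h x) (vol Ω) ∧
      ∫ x in Ω, f x * g x * h x = inner ℝ (f • g : L2 Ω) h := by
  have e : (fun x => inner ℝ ((f • g : L2 Ω) x) (h x)) =ᵐ[vol Ω] fun x => f x * g x * h x := by
    filter_upwards [Lp.coeFn_lpSMul (r := 2) f g] with x hx
    rw [hx]
    simp [mul_comm]
  refine ⟨(L2.integrable_inner (𝕜 := ℝ) (f • g : L2 Ω) h).congr e, ?_⟩
  rw [MeasureTheory.L2.inner_def]
  exact (integral_congr_ae e).symm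

theorem form_eq (a : Fin n → Fin n → Linf Ω) (c₀ : Linf Ω) (y v : H10 Ω) :
    form a c₀ y v = (∑ i, ∑ j, inner ℝ (a i j • pderiv i y : L2 Ω) (pderiv j v))
      + inner ℝ (c₀ • val y : L2 Ω) (val v) := by
  unfold form
  rw [integral_add (integrable_finsetSum _ fun i _ => integrable_finsetSum _ fun j _ =>
      (inner_smul_eq _ _ _).1) (inner_smul_eq _ _ _).1,
    integral_finsetSum _ fun i _ => integrable_finsetSum _ fun j _ => (inner_smul_eq _ _ _).1,
    (inner_smul_eq _ _ _).2]
  congr 1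
  refine Finset.sum_congr rfl fun i _ => ?_
  rw [integral_finsetSum _ fun j _ => (inner_smul_eq _ _ _).1]
  exact Finset.sum_congr rfl fun j _ => (inner_smul_eq _ _ _).2

theorem smul_smul_L2 (f : Linf Ω) (c : ℝ) (g : L2 Ω) :
    (f • (c • g) : L2 Ω) = c • (f • g : L2 Ω) := by
  rw [Lp.smul_def, Lp.smul_def]
  exact ContinuousLinearMap.holder_smul_right (ContinuousLinearMap.lsmul ℝ ℝ) c f g

theorem smul_add_L2 (f : Linf Ω) (g h : L2 Ω) :
    (f • (g + h) : L2 Ω) = (f • g : L2 Ω) + (f • h : L2 Ω) :=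
  Lp.add_smul f g h

theorem form_bound (a : Fin n → Fin n → Linf Ω) (c₀ : Linf Ω) (y v : H10 Ω) :
    ‖form a c₀ y v‖ ≤ ((∑ i, ∑ j, ‖a i j‖ * ‖pderiv (Ω := Ω) i‖ * ‖pderiv (Ω := Ω) j‖)
      + ‖c₀‖ * ‖val (Ω := Ω)‖ * ‖val (Ω := Ω)‖) * ‖y‖ * ‖v‖ := by
  have key : ∀ (f : Linf Ω) (S T : H10 Ω →L[ℝ] L2 Ω),
      ‖(inner ℝ (f • S y : L2 Ω) (T v) : ℝ)‖ ≤ ‖f‖ * ‖S‖ * ‖T‖ * ‖y‖ * ‖v‖ := by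
    intro f S T
    calc ‖(inner ℝ (f • S y : L2 Ω) (T v) : ℝ)‖ ≤ ‖(f • S y : L2 Ω)‖ * ‖T v‖ := norm_inner_le_norm _ _
      _ ≤ (‖f‖ * (‖S‖ * ‖y‖)) * (‖T‖ * ‖v‖) := by
        gcongr
        · exact (Lp.norm_smul_le f (S y)).trans (by gcongr; exact S.le_opNorm y)
        · exact T.le_opNorm v
      _ = _ := by ring
  rw [form_eq, add_mul, add_mul, Finset.sum_mul, Finset.sum_mul]
  refine (norm_add_le _ _).trans (add_le_add ((norm_sum_le _ _).trans ?_) (key _ _ _))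
  refine Finset.sum_le_sum fun i _ => ?_
  rw [Finset.sum_mul, Finset.sum_mul]
  exact (norm_sum_le _ _).trans (Finset.sum_le_sum fun j _ => key _ _ _)

/-- The operator `A ∈ 𝓛(Y, Y*)`, `A y = a(y, ·)`. -/
def opA (a : Fin n → Fin n → Linf Ω) (c₀ : Linf Ω) : H10 Ω →L[ℝ] StrongDual ℝ (H10 Ω) :=
  LinearMap.mkContinuous₂
    (LinearMap.mk₂ ℝ (form a c₀)
      (fun y y' v => by
        simp only [form_eq, map_add, smul_add_L2, inner_add_left, Finset.sum_add_distrib]; ring)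
      (fun c y v => by
        simp only [form_eq, map_smul, smul_smul_L2, real_inner_smul_left, smul_eq_mul, mul_add,
          Finset.mul_sum])
      (fun y v v' => by
        simp only [form_eq, map_add, inner_add_right, Finset.sum_add_distrib]; ring)
      (fun c y v => by
        simp only [form_eq, map_smul, real_inner_smul_right, smul_eq_mul, mul_add,
          Finset.mul_sum]))
    _ (form_bound a c₀)

/-- The operator `B ∈ 𝓛(U, Y*)`, `B u = (u, ·)_{L²(Ω)}`. -/
def opB : L2 Ω →L[ℝ] StrongDual ℝ (H10 Ω) :=
  LinearMap.mkContinuous₂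
    (LinearMap.mk₂ ℝ (fun (u : L2 Ω) (v : H10 Ω) => (inner ℝ u (val v) : ℝ))
      (fun u u' v => inner_add_left _ _ _)
      (fun c u v => real_inner_smul_left _ _ _)
      (fun u v v' => by simp only [map_add, inner_add_right])
      (fun c u v => by simp only [map_smul, real_inner_smul_right, smul_eq_mul]))
    ‖val (Ω := Ω)‖ (fun u v => by
      refine (norm_inner_le_norm (𝕜 := ℝ) u (val v)).trans ?_
      calc ‖u‖ * ‖val v‖ ≤ ‖u‖ * (‖val (Ω := Ω)‖ * ‖v‖) := by gcongr; exact val.le_opNorm v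
        _ = _ := by ring)

/-- The adjoint `T* : Y* → Y** = Y` of an operator `T : Y* → Y` on the dual of a Hilbert space `Y`.
The functional `v ↦ f (T ⟪v, ·⟫)` is represented by its Riesz vector; `adjointOfDual_spec` is the
defining property `g (T* f) = f (T g)`. -/
def adjointOfDual {Y : Type*} [NormedAddCommGroup Y] [InnerProductSpace ℝ Y] [CompleteSpace Y]
    (T : StrongDual ℝ Y →L[ℝ] Y) (f : StrongDual ℝ Y) : Y :=
  (InnerProductSpace.toDual ℝ Y).symm
    { toFun := fun v => f (T (InnerProductSpace.toDual ℝ Y v))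
      map_add' := fun v w => by simp only [map_add]
      map_smul' := fun c v => by simp
      cont := f.continuous.comp (T.continuous.comp (InnerProductSpace.toDual ℝ Y).continuous) }

theorem adjointOfDual_spec {Y : Type*} [NormedAddCommGroup Y] [InnerProductSpace ℝ Y]
    [CompleteSpace Y] (T : StrongDual ℝ Y →L[ℝ] Y) (f g : StrongDual ℝ Y) :
    g (adjointOfDual T f) = f (T g) := by
  obtain ⟨v, rfl⟩ := (InnerProductSpace.toDual ℝ Y).surjective g
  rw [InnerProductSpace.toDual_apply_apply, real_inner_comm, adjointOfDual,
    InnerProductSpace.toDual_symm_apply]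
  rfl

/-- The admissible set `U_ad = {u ∈ U | lo ≤ u ≤ hi a.e. on Ω}`. -/
def Uad (lo hi : ℝ) : Set (L2 Ω) := {u | ∀ᵐ x ∂vol Ω, lo ≤ u x ∧ u x ≤ hi}

/-- The cost `J(y, u) = ½ ‖y - y_d‖²_{L²} + (α/2) ‖u‖²_{L²} + β ‖u‖_{L¹}`. -/
def cost (yd : L2 Ω) (α β : ℝ) (y : H10 Ω) (u : L2 Ω) : ℝ :=
  1 / 2 * ‖val y - yd‖ ^ 2 + α / 2 * ‖u‖ ^ 2 + β * ∫ x in Ω, |u x|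

/-- The feasible pairs `(y, u) ∈ Y × U`: `y` is the weak solution of `L y = u + y_r` in `Ω`, `y = 0`
on `∂Ω`, that is `A y = B (u + y_r)`, and `u ∈ U_ad`. -/
def feasible (a : Fin n → Fin n → Linf Ω) (c₀ : Linf Ω) (yr : L2 Ω) (lo hi : ℝ) :
    Set (H10 Ω × L2 Ω) :=
  {w | opA a c₀ w.1 = opB (w.2 + yr) ∧ w.2 ∈ Uad lo hi}

/-- `(y, u)` is a (global) solution of the optimal control problem: it is feasible and minimizes the
cost among all feasible pairs. -/
def IsSolution (a : Fin n → Fin n → Linf Ω) (c₀ : Linf Ω) (yd yr : L2 Ω) (lo hi α β : ℝ)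
    (w : H10 Ω × L2 Ω) : Prop :=
  w ∈ feasible a c₀ yr lo hi ∧
    ∀ w' ∈ feasible a c₀ yr lo hi, cost yd α β w.1 w.2 ≤ cost yd α β w'.1 w'.2

/-- The state `A⁻¹ B y_r` that belongs to the control `0`. (`ContinuousLinearMap.inverse` is the
inverse whenever `A` is invertible.) -/
def uncontrolledState (a : Fin n → Fin n → Linf Ω) (c₀ : Linf Ω) (yr : L2 Ω) : H10 Ω :=
  (opA a c₀).inverse (opB yr)

/-- `β₀ = ‖(A⁻¹)* (y_d - A⁻¹ B y_r)‖_{L^∞(Ω)}`, a value in `[0, ∞]`; the function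
`y_d - A⁻¹ B y_r ∈ L²(Ω)` is regarded as the functional `B (y_d - A⁻¹ B y_r) ∈ Y*`. -/
def beta0 (a : Fin n → Fin n → Linf Ω) (c₀ : Linf Ω) (yd yr : L2 Ω) : ℝ≥0∞ :=
  eLpNorm (val (adjointOfDual (opA a c₀).inverse (opB (yd - val (uncontrolledState a c₀ yr)))))
    ∞ (vol Ω)

end SparseControl

end

/-! Write `y₀ = A⁻¹ B y_r` and, for a feasible pair, `y = y₀ + z` with `z = A⁻¹ B u`. Expanding the
square, `J(y, u) - J(y₀, 0) = ½‖z‖² - (y_d - y₀, z) + (α/2)‖u‖² + β‖u‖_{L¹}`. With `p = (A⁻¹)* B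
(y_d - y₀)` the cross term is `(u, p) ≤ ‖p‖_{L^∞} ‖u‖_{L¹} = β₀‖u‖_{L¹}`, so for `β ≥ β₀` the `L¹`
penalty absorbs it and the gap is at least `(α/2)‖u‖²` (`cost_uncontrolled_add_le`). This one
estimate yields both optimality and uniqueness, without an optimality system.

Invertibility of `A` is Lax-Milgram. Ellipticity controls only `∇y`; Poincaré's inequality on the
bounded set `Ω` upgrades this to coercivity in the full norm (`isCoercive_opA`). -/

namespace SparseControl

/-! ### Poincaré's inequality -/

/-- Integration by parts against a coordinate function: `∫ φ² = -2 ∫ x_i φ ∂_i φ`. -/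
theorem integral_sq_eq_of_test {n : ℕ} {Ω : TopologicalSpace.Opens (Sp n)} (φ : 𝓓(Ω, ℝ))
    (i : Fin n) :
    ∫ x, φ x * φ x
      = -∫ x, 2 * (x i * φ x * fderiv ℝ φ x (EuclideanSpace.single i 1)) := by
  have hφ : ∀ x, DifferentiableAt ℝ φ x := fun x => φ.contDiff.differentiable (by simp) x
  have dφ : Continuous fun x => fderiv ℝ φ x (EuclideanSpace.single i 1) :=
    (φ.contDiff.continuous_fderiv (by simp)).clm_apply continuous_const
  have hc : Continuous fun x : Sp n => x i := by fun_prop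
  have hφc : Continuous φ := φ.continuous
  have hd : ∀ x, fderiv ℝ (fun x => φ x * φ x) x (EuclideanSpace.single i 1)
      = 2 * (φ x * fderiv ℝ φ x (EuclideanSpace.single i 1)) := by
    intro x
    rw [fderiv_fun_mul (hφ x) (hφ x)]
    simp; ring
  have hx : ∀ x, fderiv ℝ (fun x : Sp n => x i) x (EuclideanSpace.single i 1) = 1 := by
    intro x
    have : (fun x : Sp n => x i) = (EuclideanSpace.proj i : Sp n →L[ℝ] ℝ) := rfl
    rw [this, ContinuousLinearMap.fderiv]
    simp
  -- The coordinate `x i` is unbounded, but every product involved carries a factor `φ`, hence has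
  -- compact support and is integrable.
  have key := integral_mul_fderiv_eq_neg_fderiv_mul_of_integrable (μ := (volume : Measure (Sp n)))
    (f := fun x => φ x * φ x) (g := fun x : Sp n => x i) (v := EuclideanSpace.single i 1)
    (by
      simp only [hd]
      exact ((continuous_const.mul (hφc.mul dφ)).mul hc).integrable_of_hasCompactSupport
        (φ.hasCompactSupport.mul_right.mul_left.mul_right))
    (by
      simp only [hx, mul_one]
      exact (hφc.mul hφc).integrable_of_hasCompactSupport φ.hasCompactSupport.mul_right)
    (((hφc.mul hφc).mul hc).integrable_of_hasCompactSupport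
      φ.hasCompactSupport.mul_right.mul_right)
    (fun x _ => (hφ x).mul (hφ x)) (fun x _ => by fun_prop)
  simp only [hd, hx, mul_one] at key
  rw [key]
  congr 1
  exact integral_congr_ae (Filter.Eventually.of_forall fun x => by ring)

/-- The Cauchy-Schwarz inequality for the pointwise norms of two square-integrable functions. -/
theorem integral_norm_mul_norm_le {X E F : Type*} [MeasurableSpace X] {μ : Measure X}
    [NormedAddCommGroup E] [NormedAddCommGroup F] (f : Lp E 2 μ) (g : Lp F 2 μ) :
    ∫ x, ‖f x‖ * ‖g x‖ ∂μ ≤ ‖f‖ * ‖g‖ := by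
  have m1 := (Lp.memLp f).norm
  have m2 := (Lp.memLp g).norm
  have h := real_inner_le_norm (m1.toLp _) (m2.toLp _)
  rw [L2.inner_def, Lp.norm_toLp, Lp.norm_toLp, eLpNorm_norm, eLpNorm_norm,
    ← Lp.norm_def, ← Lp.norm_def] at h
  refine le_trans (le_of_eq (integral_congr_ae ?_)) h
  filter_upwards [m1.coeFn_toLp, m2.coeFn_toLp] with x hx hx'
  rw [hx, hx', real_inner_eq_re_inner, RCLike.inner_apply, conj_trivial, RCLike.re_to_real,
    mul_comm]

/-- Poincaré's inequality for test functions. -/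
theorem poincare_of_test {n : ℕ} {Ω : TopologicalSpace.Opens (Sp n)} (i : Fin n) {R : ℝ}
    (hR : ∀ x ∈ Ω, ‖x‖ ≤ R) {w : Jet Ω} (hw : w ∈ testJets Ω) :
    ‖w.fst‖ ≤ 2 * |R| * ‖w.snd‖ := by
  obtain ⟨φ, h1, h2⟩ := hw
  have hg : ∀ x, fderiv ℝ φ x (EuclideanSpace.single i 1) = gradient φ x i := by
    intro x
    rw [← inner_gradient_left]
    simp [EuclideanSpace.inner_single_right, -inner_gradient_left]
  have e1 : ‖w.fst‖ ^ 2 = ∫ x, φ x * φ x := by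
    rw [← real_inner_self_eq_norm_sq, L2.inner_def,
      integral_congr_ae (g := fun x => φ x * φ x)
        (by filter_upwards [h1] with x hx; rw [hx]; simp [sq])]
    refine setIntegral_eq_integral_of_forall_compl_eq_zero fun x hx => ?_
    rw [image_eq_zero_of_notMem_tsupport fun h => hx (φ.tsupport_subset h), mul_zero]
  have e2 : ∫ x, 2 * (x i * φ x * fderiv ℝ φ x (EuclideanSpace.single i 1))
      = ∫ x in Ω, 2 * (x i * φ x * gradient φ x i) := by
    simp only [← hg]
    refine (setIntegral_eq_integral_of_forall_compl_eq_zero fun x hx => ?_).symm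
    rw [image_eq_zero_of_notMem_tsupport fun h => hx (φ.tsupport_subset h)]
    ring
  have e3 : ‖w.fst‖ ^ 2 ≤ ∫ x in Ω, 2 * |R| * (‖w.fst x‖ * ‖w.snd x‖) := by
    rw [e1, integral_sq_eq_of_test φ i, e2]
    have hint : Integrable (fun x => 2 * |R| * (‖w.fst x‖ * ‖w.snd x‖)) (vol Ω) :=
      ((Lp.memLp w.fst).norm.integrable_mul (Lp.memLp w.snd).norm).const_mul _
    refine (neg_le_abs _).trans ?_
    rw [← Real.norm_eq_abs]
    refine norm_integral_le_of_norm_le hint ?_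
    filter_upwards [h1, h2, ae_restrict_mem Ω.isOpen.measurableSet] with x hx hx' hxΩ
    rw [hx, hx', norm_mul, norm_mul, norm_mul, Real.norm_ofNat, mul_assoc 2, ← mul_assoc |R|]
    -- `|R|` rather than `R`: if `Ω` is empty, `hR` is vacuous and `R` may be negative.
    have a1 : ‖x i‖ ≤ |R| :=
      (PiLp.norm_apply_le x i).trans ((hR x hxΩ).trans (le_abs_self R))
    have a2 : ‖gradient φ x i‖ ≤ ‖gradient φ x‖ := PiLp.norm_apply_le _ i
    gcongr
  have e4 := integral_norm_mul_norm_le w.fst w.snd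
  rw [integral_const_mul] at e3
  have e5 : ‖w.fst‖ * ‖w.fst‖ ≤ ‖w.fst‖ * (2 * |R| * ‖w.snd‖) := by
    have := mul_le_mul_of_nonneg_left e4 (by positivity : 0 ≤ 2 * |R|)
    nlinarith
  -- The factor `‖w.fst‖` in `e5` can be cancelled only when it is nonzero.
  rcases (norm_nonneg w.fst).eq_or_lt with h0 | h0
  · rw [← h0]; positivity
  · exact le_of_mul_le_mul_left e5 h0

/-- Poincaré's inequality on `H₀¹(Ω)`. -/
theorem poincare {n : ℕ} {Ω : TopologicalSpace.Opens (Sp n)} (i : Fin n) {R : ℝ}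
    (hR : ∀ x ∈ Ω, ‖x‖ ≤ R) (y : H10 Ω) : ‖val y‖ ≤ 2 * |R| * ‖grad y‖ := by
  have hcl : IsClosed {w : Jet Ω | ‖w.fst‖ ≤ 2 * |R| * ‖w.snd‖} :=
    isClosed_le (WithLp.fstL 2 ℝ (L2 Ω) (L2Vec Ω)).continuous.norm
      (continuous_const.mul (WithLp.sndL 2 ℝ (L2 Ω) (L2Vec Ω)).continuous.norm)
  -- Both sides are continuous in the pair `(y, ∇y)`, so the bound passes from test functions to
  -- their closure.
  exact closure_minimal (fun w hw => poincare_of_test i hR hw) hcl y.2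

/-! ### Coercivity and invertibility of `A` -/

theorem norm_sq_eq {n : ℕ} {Ω : TopologicalSpace.Opens (Sp n)} (y : H10 Ω) :
    ‖y‖ ^ 2 = ‖val y‖ ^ 2 + ‖grad y‖ ^ 2 :=
  WithLp.prod_norm_sq_eq_of_L2 (y : Jet Ω)

/-- Ellipticity is applied pointwise with `ξ = ∇y(x)`, and the zeroth-order term `c₀ y²` is
nonnegative. -/
theorem form_self_ge {n : ℕ} {Ω : TopologicalSpace.Opens (Sp n)}
    {a : Fin n → Fin n → Linf Ω} {c₀ : Linf Ω} (hc₀ : ∀ᵐ x ∂vol Ω, 0 ≤ c₀ x) {θ : ℝ}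
    (ha_ell : ∀ᵐ x ∂vol Ω, ∀ ξ : Sp n, θ * ‖ξ‖ ^ 2 ≤ ∑ i, ∑ j, a i j x * ξ i * ξ j)
    (y : H10 Ω) : θ * ‖grad y‖ ^ 2 ≤ form a c₀ y y := by
  rw [← real_inner_self_eq_norm_sq, L2.inner_def, ← integral_const_mul]
  have hp : ∀ᵐ x ∂vol Ω, ∀ i, pderiv i y x = grad y x i := ae_all_iff.2 fun i => by
    filter_upwards [(EuclideanSpace.proj i : Sp n →L[ℝ] ℝ).coeFn_compLpL (p := 2) (grad y)]
      with x hx using hx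
  refine integral_mono_ae ((L2.integrable_inner (𝕜 := ℝ) (grad y) (grad y)).const_mul θ)
    ((integrable_finsetSum _ fun i _ => integrable_finsetSum _ fun j _ =>
      (inner_smul_eq _ _ _).1).add (inner_smul_eq _ _ _).1) ?_
  filter_upwards [hc₀, ha_ell, hp] with x h0 h1 h2
  have h3 := h1 (grad y x)
  simp only [h2]
  rw [real_inner_self_eq_norm_sq]
  nlinarith [mul_nonneg h0 (mul_self_nonneg (val y x))]

theorem isCoercive_opA {n : ℕ} {Ω : TopologicalSpace.Opens (Sp n)} (i : Fin n)
    (hΩ : Bornology.IsBounded (Ω : Set (Sp n)))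
    {a : Fin n → Fin n → Linf Ω} {c₀ : Linf Ω} (hc₀ : ∀ᵐ x ∂vol Ω, 0 ≤ c₀ x) {θ : ℝ}
    (hθ : 0 < θ)
    (ha_ell : ∀ᵐ x ∂vol Ω, ∀ ξ : Sp n, θ * ‖ξ‖ ^ 2 ≤ ∑ i, ∑ j, a i j x * ξ i * ξ j) :
    IsCoercive (opA a c₀) := by
  obtain ⟨R, hR⟩ := hΩ.exists_norm_le
  -- Poincaré gives `‖y‖² ≤ (1 + (2|R|)²) ‖∇y‖²`, whence this constant.
  refine ⟨θ / (1 + (2 * |R|) ^ 2), by positivity, fun y => ?_⟩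
  refine le_trans ?_ (form_self_ge hc₀ ha_ell y)
  have hv : ‖val y‖ ^ 2 ≤ (2 * |R| * ‖grad y‖) ^ 2 := by
    gcongr
    exact poincare i hR y
  have hy : ‖y‖ * ‖y‖ ≤ (1 + (2 * |R|) ^ 2) * ‖grad y‖ ^ 2 := by
    rw [← sq, norm_sq_eq]
    linarith [mul_pow (2 * |R|) ‖grad y‖ 2]
  rw [mul_assoc, div_mul_eq_mul_div, div_le_iff₀ (by positivity)]
  nlinarith

/-- Lax-Milgram: a coercive operator `V → V*` is invertible. -/
theorem _root_.IsCoercive.isInvertible {V : Type*} [NormedAddCommGroup V] [InnerProductSpace ℝ V]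
    [CompleteSpace V] {T : V →L[ℝ] StrongDual ℝ V} (hT : IsCoercive T) : T.IsInvertible := by
  -- Lax-Milgram represents the form by an isomorphism of `V`; the Riesz map then carries `V` to its
  -- dual.
  refine ⟨hT.continuousLinearEquivOfBilin.trans
    (InnerProductSpace.toDual ℝ V).toContinuousLinearEquiv, ?_⟩
  ext v w
  exact hT.continuousLinearEquivOfBilin_apply v w

/-! ### Optimality of the zero control -/

/-- Hölder's inequality between `L¹` and `L^∞` for two elements of `L²(Ω)`. -/
theorem inner_le_mul_integral_abs {n : ℕ} {Ω : TopologicalSpace.Opens (Sp n)}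
    (hΩ : Bornology.IsBounded (Ω : Set (Sp n))) {β : ℝ} (hβ : 0 ≤ β) {u p : L2 Ω}
    (hp : eLpNorm p ∞ (vol Ω) ≤ ENNReal.ofReal β) :
    (inner ℝ u p : ℝ) ≤ β * ∫ x in Ω, |u x| := by
  -- Finite measure places `u ∈ L²` in `L¹`, so the right-hand integral is a genuine one.
  have : IsFiniteMeasure (vol Ω) := isFiniteMeasure_restrict.2 hΩ.measure_lt_top.ne
  rw [L2.inner_def, ← integral_const_mul]
  refine integral_mono_ae (L2.integrable_inner (𝕜 := ℝ) u p)
    (((Lp.memLp u).integrable (by norm_num)).abs.const_mul β) ?_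
  rw [eLpNorm_exponent_top] at hp
  filter_upwards [enorm_ae_le_eLpNormEssSup p (vol Ω)] with x hx
  have hx' : ‖p x‖ ≤ β := by
    have := hx.trans hp
    rwa [← ofReal_norm, ENNReal.ofReal_le_ofReal_iff hβ] at this
  calc (inner ℝ (u x) (p x) : ℝ) ≤ ‖u x‖ * ‖p x‖ := real_inner_le_norm _ _
    _ ≤ ‖u x‖ * β := by gcongr
    _ = β * |u x| := by rw [Real.norm_eq_abs, mul_comm]

/-- The cost of a feasible pair exceeds that of the zero control by at least `(α/2)‖u‖²`. -/
theorem cost_uncontrolled_add_le {n : ℕ} {Ω : TopologicalSpace.Opens (Sp n)}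
    (hΩ : Bornology.IsBounded (Ω : Set (Sp n)))
    {a : Fin n → Fin n → Linf Ω} {c₀ : Linf Ω} (hA : (opA a c₀).IsInvertible) {yd yr : L2 Ω}
    {α β : ℝ} (hβ : 0 ≤ β) (hβ₀ : beta0 a c₀ yd yr ≤ ENNReal.ofReal β) {y : H10 Ω} {u : L2 Ω}
    (hyu : opA a c₀ y = opB (u + yr)) :
    cost yd α β (uncontrolledState a c₀ yr) 0 + α / 2 * ‖u‖ ^ 2 ≤ cost yd α β y u := by
  set y₀ := uncontrolledState a c₀ yr with hy₀
  set z := (opA a c₀).inverse (opB u) with hz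
  have hy : y = y₀ + z := by
    rw [hy₀, hz, uncontrolledState, ← map_add, ← map_add, add_comm yr u, ← hyu]
    exact (hA.inverse_apply_eq.2 rfl).symm
  -- Moving `A⁻¹` to the other factor turns this into `(u, p)`, with `p` the function whose `L^∞`
  -- norm is `beta0`.
  have hadj : (inner ℝ (yd - val y₀) (val z) : ℝ) ≤ β * ∫ x in Ω, |u x| := by
    have h := adjointOfDual_spec (opA a c₀).inverse (opB (yd - val y₀)) (opB u)
    refine le_of_eq_of_le h.symm (inner_le_mul_integral_abs hΩ hβ hβ₀)
  have h0 : ∫ x in Ω, |(0 : L2 Ω) x| = 0 := by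
    refine integral_eq_zero_of_ae ?_
    filter_upwards [Lp.coeFn_zero ℝ 2 (vol Ω)] with x hx
    rw [hx]
    simp
  have hexp : ‖val y - yd‖ ^ 2
      = ‖val y₀ - yd‖ ^ 2 - 2 * inner ℝ (yd - val y₀) (val z) + ‖val z‖ ^ 2 := by
    rw [hy, map_add, add_sub_right_comm, norm_add_sq_real, ← neg_sub yd (val y₀), inner_neg_left]
    ring
  simp only [cost, hexp, h0, norm_zero]
  -- After cancellation the claim is `0 ≤ ½‖z‖² - (y_d - y₀, z) + β‖u‖_{L¹}`.
  nlinarith [sq_nonneg ‖val z‖]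

end SparseControl

open SparseControl in
theorem lemma2p3 {n : ℕ} (hn : n = 2 ∨ n = 3)
    (Ω : TopologicalSpace.Opens (Sp n)) (hΩ_conv : Convex ℝ (Ω : Set (Sp n)))
    (hΩ_bdd : Bornology.IsBounded (Ω : Set (Sp n)))
    (a : Fin n → Fin n → Linf Ω) (c₀ : Linf Ω)
    (hc₀ : ∀ᵐ x ∂vol Ω, 0 ≤ c₀ x)
    (ha_symm : ∀ᵐ x ∂vol Ω, ∀ i j, a i j x = a j i x)
    (θ : ℝ) (hθ : 0 < θ)
    (ha_ell : ∀ᵐ x ∂vol Ω, ∀ ξ : Sp n, θ * ‖ξ‖ ^ 2 ≤ ∑ i, ∑ j, a i j x * ξ i * ξ j)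
    (yd yr : L2 Ω) (lo hi α β : ℝ) (hlo : lo ≤ 0) (hhi : 0 ≤ hi) (hα : 0 < α) (hβ : 0 < β) :
    (opA a c₀).IsInvertible ∧
      (beta0 a c₀ yd yr ≤ ENNReal.ofReal β →
        ∀ w : H10 Ω × L2 Ω, IsSolution a c₀ yd yr lo hi α β w ↔ w = (uncontrolledState a c₀ yr, 0)) := by
  -- Poincaré's inequality needs one coordinate direction; any will do.
  have i : Fin n := ⟨0, by omega⟩
  have hA : (opA a c₀).IsInvertible := (isCoercive_opA i hΩ_bdd hc₀ hθ ha_ell).isInvertible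
  refine ⟨hA, fun hβ₀ w => ?_⟩
  have hfeas : (uncontrolledState a c₀ yr, (0 : L2 Ω)) ∈ feasible a c₀ yr lo hi := by
    refine ⟨?_, ?_⟩
    · rw [zero_add]
      exact (hA.inverse_apply_eq.1 rfl).symm
    · filter_upwards [Lp.coeFn_zero ℝ 2 (vol Ω)] with x hx
      rw [hx]
      exact ⟨hlo, hhi⟩
  constructor
  · rintro ⟨hw, hmin⟩
    -- Minimality reverses the gap estimate, forcing `(α/2)‖u‖² ≤ 0`; the state equation then fixes
    -- `y`.
    have h := (cost_uncontrolled_add_le hΩ_bdd hA (α := α) hβ.le hβ₀ hw.1).trans (hmin _ hfeas)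
    have hu : w.2 = 0 := by
      have : α / 2 * ‖w.2‖ ^ 2 = 0 := le_antisymm (by linarith) (by positivity)
      simpa [hα.ne'] using this
    refine Prod.ext ?_ hu
    have h1 := hw.1
    rw [hu, zero_add] at h1
    exact (hA.inverse_apply_eq.2 h1.symm).symm
  · rintro rfl
    refine ⟨hfeas, fun w' hw' => ?_⟩
    have h := cost_uncontrolled_add_le hΩ_bdd hA (α := α) hβ.le hβ₀ hw'.1
    have : 0 ≤ α / 2 * ‖w'.2‖ ^ 2 := by positivity
    linarith
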